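/- Let $\omega>0$ and $\gamma\ge 0$ be real. Consider a qubit with orthonormal basis $|0\rangle,|1\rangle$, $\sigma_z=|0\rangle\langle 0|-|1\rangle\langle 1|$, $\sigma_x=|0\rangle\langle 1|+|1\rangle\langle 0|$, $\sigma_-=|0\rangle\langle 1|$, $\sigma_+=\sigma_-^\dagger$. For a real control field $f$ integrable on $[0,T]$, $T\ge 0$, let $\rho:[0,T]\to M_2(\mathbb C)$ be a solution (continuous, and satisfying the integrated equation) of the Lindblad master equation $$\frac{d\rho}{dt}=-i[H(t),\rho]+\mathcal D(\rho),\qquad H(t)=-\omega\sigma_z+f(t)\sigma_x,$$ $$\mathcal D(\rho)=\gamma\,(2\sigma_-\rho\sigma_+-\sigma_+\sigma_-\rho-\rho\,\sigma_+\sigma_-),$$ with initial state $\rho(0)=|-\rangle\langle -|$, where $|-\rangle=(|0\rangle-|1\rangle)/\sqrt2$. If $\rho(T)=|0\rangle\langle 0|$, then $$T\ \ge\ \frac{1}{\sqrt2\,|\gamma+2i\omega|}.$$ The same lower bound holds if the target $|0\rangle\langle 0|$ is only reached approximately, up to trace distance $\tfrac12\|\rho(T)-|0\rangle\langle 0|\|_1\le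 \tfrac1{10}$, where $\|A\|_1=\operatorname{Tr}\sqrt{A^\dagger A}$. Thus the bound does not depend on the control field $f$. -/

import Mathlib

noncomputable section

namespace DampedQubit

open Matrix

/-- The operators of a qubit, written in the computational basis `|0⟩, |1⟩`. -/
abbrev Op := Matrix (Fin 2) (Fin 2) ℂ

/-- The basis vector `|0⟩`. -/
def ket0 : Fin 2 → ℂ := ![1, 0]

/-- The basis vector `|1⟩`. -/
def ket1 : Fin 2 → ℂ := ![0, 1]

/-- The vector `|-⟩ = (|0⟩ - |1⟩) / √2`. -/
def ketMinus : Fin 2 → ℂ := ((Real.sqrt 2 : ℝ) : ℂ)⁻¹ • (ket0 - ket1)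

/-- The operator `|φ⟩⟨ψ|`. -/
def ketBra (φ ψ : Fin 2 → ℂ) : Op := vecMulVec φ (star ψ)

/-- The Pauli operator `σ_x`. -/
def pauliX : Op := !![0, 1; 1, 0]

/-- The Pauli operator `σ_z`. -/
def pauliZ : Op := !![1, 0; 0, -1]

/-- The lowering operator `σ_- = |0⟩⟨1|`. -/
def sigmaMinus : Op := ketBra ket0 ket1

/-- The raising operator `σ_+ = σ_-†`. -/
def sigmaPlus : Op := sigmaMinusᴴ

/-- The Hamiltonian `-ω σ_z + u σ_x`, where `u` is the current value of the control field. -/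
def hamiltonian (ω u : ℝ) : Op := -(ω : ℂ) • pauliZ + (u : ℂ) • pauliX

/-- The amplitude damping dissipator
`D(ρ) = γ (2 σ_- ρ σ_+ - σ_+ σ_- ρ - ρ σ_+ σ_-)`. -/
def dissipator (γ : ℝ) (ρ : Op) : Op :=
  (γ : ℂ) • ((2 : ℂ) • (sigmaMinus * ρ * sigmaPlus)
    - sigmaPlus * sigmaMinus * ρ - ρ * (sigmaPlus * sigmaMinus))

/-- The Lindblad generator `ρ ↦ -i [H, ρ] + D(ρ)` at control value `u`. -/
def lindbladian (ω γ u : ℝ) (ρ : Op) : Op :=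
  -Complex.I • (hamiltonian ω u * ρ - ρ * hamiltonian ω u) + dissipator γ ρ

/-- `ρ` solves the Lindblad master equation `dρ/dt = -i [-ω σ_z + f(t) σ_x, ρ] + D(ρ)` on
`[0, T]` with initial state `ρ₀`, in the (Carathéodory) sense suited to control fields that are
merely integrable, such as piecewise constant ones: `ρ` is continuous and each matrix entry
satisfies the integrated equation. -/
structure IsTrajectory (ω γ : ℝ) (f : ℝ → ℝ) (T : ℝ) (ρ₀ : Op) (ρ : ℝ → Op) : Prop where
  continuousOn : ContinuousOn ρ (Set.Icc 0 T)
  integral_eq : ∀ t ∈ Set.Icc (0 : ℝ) T, ∀ i j : Fin 2,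
    ρ t i j = ρ₀ i j + ∫ s in (0 : ℝ)..t, lindbladian ω γ (f s) (ρ s) i j

/-- The trace norm `‖A‖₁ = Tr √(A†A)`, that is, the sum of the square roots of the eigenvalues
of `A†A`, counted with multiplicity. -/
def traceNorm (A : Op) : ℝ :=
  ∑ i, Real.sqrt ((isHermitian_conjTranspose_mul_self A).eigenvalues i)

/-- The trace distance `‖A - B‖₁ / 2`. -/
def traceDist (A B : Op) : ℝ := traceNorm (A - B) / 2

end DampedQubit

end

/-! Follow the Bloch component $x=\mathrm{Re}\,\mathrm{Tr}(\sigma_x\rho)$. The control term commutes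
with $\sigma_x$, so $x'=2\omega y-\gamma x$ does not involve $f$, and Cauchy-Schwarz gives
$|x'|\le|\gamma+2i\omega|$ as long as $x^2+y^2\le1$ (`abs_expect_pauliX_sub_le`). Since $x$ starts
at $-1$ and ends near $0$, the time is bounded below.

The Bloch ball is preserved because $u=x^2+y^2+z^2-1$ satisfies $u'=-2\gamma(u+(z-1)^2)$, again free
of $f$ (`bloch_le_one`). Real parts of expectations suffice, so Hermiticity and positivity of
$\rho(t)$ are never needed. -/

open MeasureTheory Set in
/-- The square of a primitive `x` of `g` is a primitive of `2 x g`. -/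
theorem sq_eq_add_integral {x g : ℝ → ℝ} {a T : ℝ} (hg : IntervalIntegrable g volume 0 T)
    (hx : ∀ t ∈ Icc 0 T, x t = a + ∫ s in (0 : ℝ)..t, g s) {t : ℝ} (ht : t ∈ Icc 0 T) :
    IntervalIntegrable (fun s => 2 * x s * g s) volume 0 t ∧
      x t ^ 2 = a ^ 2 + ∫ s in (0 : ℝ)..t, 2 * x s * g s := by
  have hsub : uIcc 0 t ⊆ uIcc 0 T := by
    rw [uIcc_of_le ht.1, uIcc_of_le (ht.1.trans ht.2)]
    exact Icc_subset_Icc_right ht.2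
  have hgt : IntervalIntegrable g volume 0 t := hg.mono_set hsub
  set F : ℝ → ℝ := fun r => ∫ s in (0 : ℝ)..r, g s with hF
  have hac : AbsolutelyContinuousOnInterval F 0 t :=
    hgt.absolutelyContinuousOnInterval_intervalIntegral left_mem_uIcc
  have hFg : IntervalIntegrable (fun s => F s * g s) volume 0 t :=
    hgt.continuousOn_mul hac.continuousOn
  -- Integration by parts of `F` against itself; absolute continuity suffices, as `g` is merely
  -- integrable.
  have key : ∫ s in (0 : ℝ)..t, 2 * (F s * g s) = F t ^ 2 := by
    have h := hac.integral_deriv_mul_eq_sub hac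
    have h0 : F 0 = 0 := by simp [hF]
    rw [h0] at h
    calc ∫ s in (0 : ℝ)..t, 2 * (F s * g s)
        = ∫ s in (0 : ℝ)..t, deriv F s * F s + F s * deriv F s := by
          refine intervalIntegral.integral_congr_ae ?_
          filter_upwards [hgt.ae_hasDerivAt_integral] with s hs hs'
          rw [(hs (uIoc_subset_uIcc hs') 0 left_mem_uIcc).deriv]
          ring
      _ = F t ^ 2 := by rw [h]; ring
  have hcongr : EqOn (fun s => 2 * a * g s + 2 * (F s * g s)) (fun s => 2 * x s * g s)
      (uIcc 0 t) := by
    intro s hs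
    have hs' := hsub hs
    rw [uIcc_of_le (ht.1.trans ht.2)] at hs'
    simp only [hx s hs', hF]
    ring
  have hint := (hgt.const_mul (2 * a)).add (hFg.const_mul 2)
  refine ⟨hint.congr (fun s hs => hcongr (uIoc_subset_uIcc hs)), ?_⟩
  rw [← intervalIntegral.integral_congr hcongr,
    intervalIntegral.integral_add (hgt.const_mul (2 * a)) (hFg.const_mul 2), key,
    intervalIntegral.integral_const_mul, hx t ht]
  simp only [hF]
  ring

open MeasureTheory Set in
/-- A solution of `u' = -c (u + w)` with `w ≥ 0` that starts at `0` is nonpositive. -/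
theorem nonpos_of_eq_integral {u w : ℝ → ℝ} {c T : ℝ} (hc : 0 ≤ c)
    (hu : ContinuousOn u (Icc 0 T)) (hw : ContinuousOn w (Icc 0 T)) (hw0 : ∀ t, 0 ≤ w t)
    (h : ∀ t ∈ Icc 0 T, u t = ∫ s in (0 : ℝ)..t, -c * (u s + w s)) :
    ∀ t ∈ Icc 0 T, u t ≤ 0 := by
  intro t ht
  have hT : (0 : ℝ) ≤ T := ht.1.trans ht.2
  have hcont : ContinuousOn (fun s => -c * (u s + w s)) (Icc 0 T) :=
    continuousOn_const.mul (hu.add hw)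
  have hderiv : ∀ s ∈ Ioo 0 T, HasDerivAt u (-c * (u s + w s)) s := by
    intro s hs
    have hnhds : Icc 0 T ∈ nhds s := Icc_mem_nhds hs.1 hs.2
    have hint : IntervalIntegrable (fun s => -c * (u s + w s)) volume 0 s := by
      refine (hcont.mono ?_).intervalIntegrable
      rw [uIcc_of_le hs.1.le]
      exact Icc_subset_Icc_right hs.2.le
    refine (intervalIntegral.integral_hasDerivAt_right hint
      (hcont.stronglyMeasurableAtFilter_nhdsWithin measurableSet_Icc s |>.filter_mono ?_)
      (hcont.continuousAt hnhds)).congr_of_eventuallyEq ?_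
    · rw [nhdsWithin_eq_nhds.2 hnhds]
    · filter_upwards [hnhds] with r hr using h r hr
  -- The integrating factor $e^{cr}$ leaves only the nonpositive source term.
  have hd : ∀ s ∈ Ioo 0 T, HasDerivAt (fun r => Real.exp (c * r) * u r)
      (-(c * Real.exp (c * s) * w s)) s := by
    intro s hs
    have h1 : HasDerivAt (fun r => Real.exp (c * r)) (Real.exp (c * s) * (c * 1)) s :=
      ((hasDerivAt_id s).const_mul c).exp
    exact (h1.mul (hderiv s hs)).congr_deriv (by ring)
  have hanti : AntitoneOn (fun r => Real.exp (c * r) * u r) (Icc 0 T) := by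
    refine antitoneOn_of_deriv_nonpos (convex_Icc 0 T)
      ((by fun_prop : Continuous fun r => Real.exp (c * r)).continuousOn.mul hu) ?_ ?_
    · rw [interior_Icc]
      exact fun s hs => (hd s hs).differentiableAt.differentiableWithinAt
    · rw [interior_Icc]
      intro s hs
      rw [(hd s hs).deriv]
      exact neg_nonpos.2 (mul_nonneg (mul_nonneg hc (Real.exp_pos _).le) (hw0 s))
  have h0 : u 0 = 0 := by simpa using h 0 ⟨le_rfl, hT⟩
  have := hanti ⟨le_rfl, hT⟩ ht ht.1
  simp only [h0, mul_zero] at this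
  exact nonpos_of_mul_nonpos_right this (Real.exp_pos _)

/-! ### Bloch components and their equations of motion. -/

namespace DampedQubit

open Matrix MeasureTheory Set

/-- The Pauli operator `σ_y`. -/
def pauliY : Op := !![0, -Complex.I; Complex.I, 0]

/-- The real part of the expectation value `Tr(P ρ)`. -/
def expect (P A : Op) : ℝ := (P * A).trace.re

theorem expect_eq (P A : Op) :
    expect P A = (P 0 0 * A 0 0).re + (P 0 1 * A 1 0).re
      + ((P 1 0 * A 0 1).re + (P 1 1 * A 1 1).re) := by
  simp only [expect, trace_fin_two, mul_apply, Fin.sum_univ_two, Complex.add_re]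

theorem continuous_expect (P : Op) : Continuous (expect P) := by
  unfold expect
  fun_prop

theorem expect_pauliX (A : Op) : expect pauliX A = (A 0 1).re + (A 1 0).re := by
  simp [expect_eq, pauliX, add_comm]

theorem ketBra_apply (φ ψ : Fin 2 → ℂ) (i j : Fin 2) : ketBra φ ψ i j = φ i * star (ψ j) := rfl

theorem sigmaMinus_eq : sigmaMinus = !![0, 1; 0, 0] := by
  ext i j
  fin_cases i <;> fin_cases j <;> simp [sigmaMinus, ketBra_apply, ket0, ket1]

theorem sigmaPlus_eq : sigmaPlus = !![0, 0; 1, 0] := by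
  ext i j
  fin_cases i <;> fin_cases j <;> simp [sigmaPlus, sigmaMinus_eq]

theorem lindbladian_eq (ω γ u : ℝ) (A : Op) :
    lindbladian ω γ u A =
      !![Complex.I * u * (A 0 1 - A 1 0) + 2 * γ * A 1 1,
         Complex.I * (2 * ω * A 0 1 + u * (A 0 0 - A 1 1)) - γ * A 0 1;
         -Complex.I * (2 * ω * A 1 0 + u * (A 0 0 - A 1 1)) - γ * A 1 0,
         Complex.I * u * (A 1 0 - A 0 1) - 2 * γ * A 1 1] := by
  rw [eta_fin_two A]
  ext i j
  fin_cases i <;> fin_cases j <;>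
    simp [lindbladian, hamiltonian, dissipator, sigmaMinus_eq, sigmaPlus_eq, pauliX, pauliZ] <;>
    ring

theorem expect_one_lindbladian (ω γ u : ℝ) (A : Op) : expect 1 (lindbladian ω γ u A) = 0 := by
  simp [expect_eq, lindbladian_eq]
  ring

theorem expect_pauliX_lindbladian (ω γ u : ℝ) (A : Op) :
    expect pauliX (lindbladian ω γ u A) = 2 * ω * expect pauliY A - γ * expect pauliX A := by
  simp [expect_eq, lindbladian_eq, pauliX, pauliY]
  ring

theorem expect_pauliY_lindbladian (ω γ u : ℝ) (A : Op) :
    expect pauliY (lindbladian ω γ u A) =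
      -2 * ω * expect pauliX A - 2 * u * expect pauliZ A - γ * expect pauliY A := by
  simp [expect_eq, lindbladian_eq, pauliX, pauliY, pauliZ]
  ring

theorem expect_pauliZ_lindbladian (ω γ u : ℝ) (A : Op) :
    expect pauliZ (lindbladian ω γ u A) =
      2 * u * expect pauliY A + 2 * γ * (expect 1 A - expect pauliZ A) := by
  simp [expect_eq, lindbladian_eq, pauliY, pauliZ]
  ring

theorem ketBra_ketMinus : ketBra ketMinus ketMinus = !![1 / 2, -1 / 2; -1 / 2, 1 / 2] := by
  have h : (((Real.sqrt 2 : ℝ) : ℂ)⁻¹) * ((Real.sqrt 2 : ℝ) : ℂ)⁻¹ = 1 / 2 := by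
    rw [← mul_inv, ← Complex.ofReal_mul, Real.mul_self_sqrt (by norm_num)]
    norm_num
  ext i j
  fin_cases i <;> fin_cases j <;>
    simp [ketBra_apply, ketMinus, ket0, ket1, h] <;> norm_num

theorem expect_pauliX_ketBra_ket0 : expect pauliX (ketBra ket0 ket0) = 0 := by
  simp [expect_pauliX, ketBra_apply, ket0]

theorem expect_sub (P A B : Op) : expect P (A - B) = expect P A - expect P B := by
  simp [expect, mul_sub]

/-! ### Integrated Bloch equations and the speed limit. -/

namespace IsTrajectory

variable {ω γ T : ℝ} {f : ℝ → ℝ} {ρ₀ : Op} {ρ : ℝ → Op}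

theorem intervalIntegrable_lindbladian (h : IsTrajectory ω γ f T ρ₀ ρ) (hT : 0 ≤ T)
    (hf : IntervalIntegrable f volume 0 T) (i j : Fin 2) :
    IntervalIntegrable (fun s => lindbladian ω γ (f s) (ρ s) i j) volume 0 T := by
  have hρ := h.continuousOn
  rw [← uIcc_of_le hT] at hρ
  have hρij : ∀ i j, ContinuousOn (fun s => ρ s i j) (uIcc 0 T) := fun i j =>
    (continuous_apply_apply i j).comp_continuousOn hρ
  -- The generator is affine in the control: each entry is a continuous function plus `f` times a
  -- continuous function.
  have hsplit : ∀ s, lindbladian ω γ (f s) (ρ s) i j = lindbladian ω γ 0 (ρ s) i j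
      + (f s : ℂ) * lindbladian 0 0 1 (ρ s) i j := by
    intro s
    fin_cases i <;> fin_cases j <;> simp [lindbladian_eq] <;> ring
  have hL : ∀ a b u : ℝ, ContinuousOn (fun s => lindbladian a b u (ρ s) i j) (uIcc 0 T) := by
    intro a b u
    have h00 := hρij 0 0
    have h01 := hρij 0 1
    have h10 := hρij 1 0
    have h11 := hρij 1 1
    fin_cases i <;> fin_cases j <;> simp only [lindbladian_eq] <;> simp <;> fun_prop
  simp only [hsplit]
  have hfC : IntervalIntegrable (fun s => (f s : ℂ)) volume 0 T :=
    ⟨hf.1.ofReal, hf.2.ofReal⟩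
  exact (hL ω γ 0).intervalIntegrable.add (hfC.mul_continuousOn (hL 0 0 1))

theorem expect_eq_integral (h : IsTrajectory ω γ f T ρ₀ ρ) (hT : 0 ≤ T)
    (hf : IntervalIntegrable f volume 0 T) (P : Op) :
    IntervalIntegrable (fun s => expect P (lindbladian ω γ (f s) (ρ s))) volume 0 T ∧
    ∀ t ∈ Icc 0 T, expect P (ρ t) =
      expect P ρ₀ + ∫ s in (0 : ℝ)..t, expect P (lindbladian ω γ (f s) (ρ s)) := by
  have hL := h.intervalIntegrable_lindbladian hT hf
  have hre : ∀ {g : ℝ → ℂ} {t : ℝ}, IntervalIntegrable g volume 0 t →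
      IntervalIntegrable (fun s => (g s).re) volume 0 t := fun hg => ⟨hg.1.re, hg.2.re⟩
  have hPL : ∀ i j, IntervalIntegrable (fun s => P i j * lindbladian ω γ (f s) (ρ s) j i)
      volume 0 T := fun i j => (hL j i).const_mul _
  simp only [expect_eq]
  refine ⟨((hre (hPL 0 0)).add (hre (hPL 0 1))).add ((hre (hPL 1 0)).add (hre (hPL 1 1))), ?_⟩
  intro t ht
  have hsub : uIcc 0 t ⊆ uIcc 0 T := by
    rw [uIcc_of_le ht.1, uIcc_of_le hT]
    exact Icc_subset_Icc_right ht.2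
  have hPt : ∀ i j, IntervalIntegrable (fun s => P i j * lindbladian ω γ (f s) (ρ s) j i)
      volume 0 t := fun i j => (hPL i j).mono_set hsub
  have hcomm : ∀ i j, (P i j * ρ t j i).re = (P i j * ρ₀ j i).re
      + ∫ s in (0 : ℝ)..t, (P i j * lindbladian ω γ (f s) (ρ s) j i).re := by
    intro i j
    have := Complex.reCLM.intervalIntegral_comp_comm (hPt i j)
    simp only [Complex.reCLM_apply] at this
    rw [this, intervalIntegral.integral_const_mul, h.integral_eq t ht j i, mul_add,
      Complex.add_re]
  rw [intervalIntegral.integral_add ((hre (hPt 0 0)).add (hre (hPt 0 1)))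
      ((hre (hPt 1 0)).add (hre (hPt 1 1))),
    intervalIntegral.integral_add (hre (hPt 0 0)) (hre (hPt 0 1)),
    intervalIntegral.integral_add (hre (hPt 1 0)) (hre (hPt 1 1)),
    hcomm, hcomm, hcomm, hcomm]
  ring

/-- The Bloch vector of a trajectory that starts in a pure state stays in the unit ball. -/
theorem bloch_le_one (h : IsTrajectory ω γ f T ρ₀ ρ) (hT : 0 ≤ T) (hγ : 0 ≤ γ)
    (hf : IntervalIntegrable f volume 0 T) (htr : expect 1 ρ₀ = 1)
    (hpure : expect pauliX ρ₀ ^ 2 + expect pauliY ρ₀ ^ 2 + expect pauliZ ρ₀ ^ 2 = 1) :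
    ∀ t ∈ Icc 0 T,
      expect pauliX (ρ t) ^ 2 + expect pauliY (ρ t) ^ 2 + expect pauliZ (ρ t) ^ 2 ≤ 1 := by
  have htrace : ∀ t ∈ Icc 0 T, expect 1 (ρ t) = 1 := by
    intro t ht
    rw [(h.expect_eq_integral hT hf 1).2 t ht, htr]
    simp [expect_one_lindbladian]
  have hcont : ∀ P, ContinuousOn (fun t => expect P (ρ t)) (Icc 0 T) := fun P =>
    (continuous_expect P).comp_continuousOn h.continuousOn
  have hX := hcont pauliX
  have hY := hcont pauliY
  have hZ := hcont pauliZ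
  have key := nonpos_of_eq_integral (T := T) (c := 2 * γ)
    (u := fun t => expect pauliX (ρ t) ^ 2 + expect pauliY (ρ t) ^ 2 + expect pauliZ (ρ t) ^ 2 - 1)
    (w := fun t => (expect pauliZ (ρ t) - 1) ^ 2) (by positivity) (by fun_prop) (by fun_prop)
    (fun t => sq_nonneg _) ?_
  · exact fun t ht => sub_nonpos.1 (key t ht)
  intro t ht
  have hsq := fun P => sq_eq_add_integral (h.expect_eq_integral hT hf P).1
    (h.expect_eq_integral hT hf P).2 ht
  simp only [(hsq _).2]
  rw [show ∀ a b c d e g : ℝ, a + b + (c + d) + (e + g) - 1 = a + c + e - 1 + (b + d + g) by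
      intros; ring, hpure, sub_self, zero_add,
    ← intervalIntegral.integral_add (hsq _).1 (hsq _).1,
    ← intervalIntegral.integral_add ((hsq _).1.add (hsq _).1) (hsq _).1]
  refine intervalIntegral.integral_congr fun s hs => ?_
  rw [uIcc_of_le ht.1] at hs
  simp only [expect_pauliX_lindbladian, expect_pauliY_lindbladian, expect_pauliZ_lindbladian,
    htrace s ⟨hs.1, hs.2.trans ht.2⟩]
  ring

/-- The speed limit for the `x`-component of the Bloch vector. -/
theorem abs_expect_pauliX_sub_le (h : IsTrajectory ω γ f T ρ₀ ρ) (hT : 0 ≤ T) (hγ : 0 ≤ γ)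
    (hf : IntervalIntegrable f volume 0 T) (htr : expect 1 ρ₀ = 1)
    (hpure : expect pauliX ρ₀ ^ 2 + expect pauliY ρ₀ ^ 2 + expect pauliZ ρ₀ ^ 2 = 1) :
    |expect pauliX (ρ T) - expect pauliX ρ₀| ≤ ‖(γ : ℂ) + 2 * Complex.I * (ω : ℂ)‖ * T := by
  have hball := h.bloch_le_one hT hγ hf htr hpure
  rw [(h.expect_eq_integral hT hf pauliX).2 T ⟨hT, le_rfl⟩, add_sub_cancel_left,
    ← Real.norm_eq_abs]
  have := intervalIntegral.norm_integral_le_of_norm_le_const (a := 0) (b := T)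
    (C := ‖(γ : ℂ) + 2 * Complex.I * (ω : ℂ)‖)
    (f := fun s => expect pauliX (lindbladian ω γ (f s) (ρ s))) ?_
  · simpa [abs_of_nonneg hT] using this
  intro s hs
  rw [uIoc_of_le hT] at hs
  have hb := hball s ⟨hs.1.le, hs.2⟩
  have hn : ‖(γ : ℂ) + 2 * Complex.I * (ω : ℂ)‖ ^ 2 = γ ^ 2 + 4 * ω ^ 2 := by
    rw [Complex.sq_norm, Complex.normSq_apply]
    simp
    ring
  rw [Real.norm_eq_abs, expect_pauliX_lindbladian]
  refine abs_le_of_sq_le_sq ?_ (norm_nonneg _)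
  rw [hn]
  set x := expect pauliX (ρ s)
  set y := expect pauliY (ρ s)
  have h1 : x ^ 2 + y ^ 2 ≤ 1 := by nlinarith [sq_nonneg (expect pauliZ (ρ s))]
  -- Cauchy-Schwarz; the two sides differ by exactly $(2\omega x+\gamma y)^2$.
  calc (2 * ω * y - γ * x) ^ 2 ≤ (γ ^ 2 + 4 * ω ^ 2) * (x ^ 2 + y ^ 2) := by
        nlinarith [sq_nonneg (2 * ω * x + γ * y)]
    _ ≤ (γ ^ 2 + 4 * ω ^ 2) * 1 := by gcongr
    _ = _ := mul_one _

end IsTrajectory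

/-! ### Trace norm and the final numerical estimate. -/

open scoped ComplexOrder in
/-- The Hilbert-Schmidt norm is at most the trace norm. -/
theorem sum_normSq_le_traceNorm_sq (A : Op) :
    ∑ i, ∑ j, ‖A i j‖ ^ 2 ≤ traceNorm A ^ 2 := by
  have hpos := (posSemidef_conjTranspose_mul_self A).eigenvalues_nonneg
  have htr := congrArg Complex.re
    (isHermitian_conjTranspose_mul_self A).trace_eq_sum_eigenvalues
  have hL : (Aᴴ * A).trace.re = ∑ i, ∑ j, ‖A i j‖ ^ 2 := by
    simp only [trace_fin_two, mul_apply, Fin.sum_univ_two, conjTranspose_apply, Complex.sq_norm,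
      Complex.normSq_apply]
    simp
    ring
  rw [hL] at htr
  rw [htr, traceNorm]
  simp only [Fin.sum_univ_two] at hpos ⊢
  simp only [Complex.add_re, Complex.coe_algebraMap, Complex.ofReal_re]
  have h0 := Real.sq_sqrt (hpos 0)
  have h1 := Real.sq_sqrt (hpos 1)
  have := mul_nonneg (Real.sqrt_nonneg ((isHermitian_conjTranspose_mul_self A).eigenvalues 0))
    (Real.sqrt_nonneg ((isHermitian_conjTranspose_mul_self A).eigenvalues 1))
  nlinarith

/-- Only the off-diagonal entries enter, and $(a+b)^2\le2(a^2+b^2)$. The factor 2 is not sharp, but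
the final estimate has room for it. -/
theorem expect_pauliX_sq_le (A : Op) : expect pauliX A ^ 2 ≤ 2 * traceNorm A ^ 2 := by
  have h := sum_normSq_le_traceNorm_sq A
  simp only [Fin.sum_univ_two, Complex.sq_norm, Complex.normSq_apply] at h
  rw [expect_pauliX]
  nlinarith [sq_nonneg ((A 0 1).re - (A 1 0).re), sq_nonneg (A 0 0).re, sq_nonneg (A 0 0).im,
    sq_nonneg (A 1 1).re, sq_nonneg (A 1 1).im, sq_nonneg (A 0 1).im, sq_nonneg (A 1 0).im]

theorem traceNorm_nonneg (A : Op) : 0 ≤ traceNorm A :=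
  Finset.sum_nonneg fun _ _ => Real.sqrt_nonneg _

theorem expect_pauliX_sq_le_of_traceDist_le {A : Op}
    (h : traceDist A (ketBra ket0 ket0) ≤ 1 / 10) : expect pauliX A ^ 2 ≤ 2 / 25 := by
  have h1 := expect_pauliX_sq_le (A - ketBra ket0 ket0)
  have h0 := traceNorm_nonneg (A - ketBra ket0 ket0)
  rw [expect_sub, expect_pauliX_ketBra_ket0, sub_zero] at h1
  rw [traceDist] at h
  nlinarith

/-- A trajectory from `|-⟩⟨-|` whose final `x`-component is close to `0` takes a time bounded
below independently of the control. -/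
theorem IsTrajectory.time_ge {ω γ T : ℝ} {f : ℝ → ℝ} {ρ : ℝ → Op} (hω : 0 < ω) (hγ : 0 ≤ γ)
    (hT : 0 ≤ T) (hf : IntervalIntegrable f volume 0 T)
    (h : IsTrajectory ω γ f T (ketBra ketMinus ketMinus) ρ)
    (hend : expect pauliX (ρ T) ^ 2 ≤ 2 / 25) :
    T ≥ 1 / (Real.sqrt 2 * ‖(γ : ℂ) + 2 * Complex.I * (ω : ℂ)‖) := by
  have hX : expect pauliX (ketBra ketMinus ketMinus) = -1 := by
    rw [ketBra_ketMinus]; simp [expect_eq, pauliX]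
  have hY : expect pauliY (ketBra ketMinus ketMinus) = 0 := by
    rw [ketBra_ketMinus]; simp [expect_eq, pauliY]
  have hZ : expect pauliZ (ketBra ketMinus ketMinus) = 0 := by
    rw [ketBra_ketMinus]; simp [expect_eq, pauliZ]
  have hI : expect 1 (ketBra ketMinus ketMinus) = 1 := by
    rw [ketBra_ketMinus]; simp [expect_eq]; norm_num
  have hspeed := h.abs_expect_pauliX_sub_le hT hγ hf hI (by rw [hX, hY, hZ]; norm_num)
  rw [hX] at hspeed
  have hK : 0 < ‖(γ : ℂ) + 2 * Complex.I * (ω : ℂ)‖ := by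
    refine norm_pos_iff.2 fun h0 => hω.ne' ?_
    simpa using congrArg Complex.im h0
  -- $0.29^2=0.0841>2/25$. The travelled distance is thus at least $0.71$, and
  -- $0.71\cdot1.41=1.0011>1$ closes the bound.
  have hx : -(29 / 100) ≤ expect pauliX (ρ T) := by
    by_contra! hlt
    nlinarith
  have h2 : (1.41 : ℝ) ≤ Real.sqrt 2 := Real.le_sqrt_of_sq_le (by norm_num)
  have h3 := (le_abs_self _).trans hspeed
  rw [ge_iff_le, div_le_iff₀ (by positivity)]
  nlinarith

end DampedQubit

theorem mainTheorem6 (ω γ : ℝ) (hω : 0 < ω) (hγ : 0 ≤ γ)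
    (T : ℝ) (hT : 0 ≤ T) (f : ℝ → ℝ) (hf : IntervalIntegrable f MeasureTheory.volume 0 T)
    (ρ : ℝ → DampedQubit.Op)
    (hρ : DampedQubit.IsTrajectory ω γ f T
      (DampedQubit.ketBra DampedQubit.ketMinus DampedQubit.ketMinus) ρ) :
    (ρ T = DampedQubit.ketBra DampedQubit.ket0 DampedQubit.ket0 →
      T ≥ 1 / (Real.sqrt 2 * ‖(γ : ℂ) + 2 * Complex.I * (ω : ℂ)‖)) ∧
    (DampedQubit.traceDist (ρ T) (DampedQubit.ketBra DampedQubit.ket0 DampedQubit.ket0) ≤ 1 / 10 →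
      T ≥ 1 / (Real.sqrt 2 * ‖(γ : ℂ) + 2 * Complex.I * (ω : ℂ)‖)) := by
  have key := fun h => DampedQubit.IsTrajectory.time_ge hω hγ hT hf hρ h
  refine ⟨fun h => key ?_, fun h => key (DampedQubit.expect_pauliX_sq_le_of_traceDist_le h)⟩
  rw [h, DampedQubit.expect_pauliX_ketBra_ket0]
  norm_num
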